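/- For $n\ge 0$ let the menage number $M_n$ be the number of ways to seat $n$ married couples (each of one woman and one man) on $2n$ labelled seats around a circular table so that no two neighbours are spouses and no two neighbours are of the same sex (so $M_0=1$, $M_1=M_2=0$, $M_3=12$). For all integers $n>1$, $$M_n = 2\cdot n!\cdot\int_0^\infty\left(\left(\frac{t-2+\sqrt{t^2-4t}}{2}\right)^n+\left(\frac{t-2-\sqrt{t^2-4t}}{2}\right)^n\right)e^{-t}\,dt ,$$ the integral being absolutely convergent (for $0<t<4$ the square root is imaginary). Furthermore, the exponential generating function of the menage numbers satisfies $$\begin{aligned}\sum_{n=0}^\infty M_n\frac{x^n}{n!} &= -1+2x+2\int_0^\infty\frac{x^2-1}{xt-(x+1)^2}\,e^{-t}\,dt &(1)\\ &= -1+2x+2\cdot\frac{1-x}{1+x}\cdot\sum_{k=0}^\infty\frac{k!\,x^k}{(1+x)^{2k}} &(2)\\ &= -1+2x+2\cdot\frac{1-x^2}{x}\cdot e^{-(x+1)^2/x}\cdot\mathrm{Ei}\left(\frac{(x+1)^2}{x}\right), &(3)\end{aligned}$$ where $\mathrm{Ei}(z)=\int_{-\infty}^z \frac{e^t}{t}\,dt$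 for real $z\neq 0$ (a Cauchy principal value at $0$ if $z>0$) is the exponential integral. The power series on the left has radius of convergence $0$, and the equalities have the following meaning. * (1) and (2) are identities of formal power series in $x$. In (1) the integrand is expanded as a formal power series in $x$, and it is integrated coefficient by coefficient (each coefficient is integrable); the infinite sum in (2) converges in the topology of coefficientwise convergence. * In (3) the generating function is the asymptotic expansion, as $x\to 0$ through real $x\ne0$, of the function on the right: for every $N\ge 0$ that function differs from $\sum_{n<N}M_n\frac{x^n}{n!}$ by $O(x^N)$. The value $\mathrm{Ei}((x+1)^2/x)$ exists for all real $x\ne 0,-1$. * The right-hand sides of (1) and (3) are also equal as functions of a real variable: for all $x<0$, $x\neq -1$, where the integral converges absolutely, and for all $x>0$, where the integral is a Cauchy principal value at $t=(x+1)^2/x$. -/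

import Mathlib

open MeasureTheory Filter Topology
open scoped Nat PowerSeries PowerSeries.WithPiTopology

noncomputable section

/-- A seating of `n` married couples on the `2n` (labelled) seats of a circular table. A person is
a pair `(c, s)`: the number `c` of the couple and the sex `s`. The clockwise neighbour of seat `i`
is seat `finRotate (2 * n) i`, that is `i + 1` modulo `2 * n`. The seating is a menage seating if
neighbours never belong to the same couple and are never of the same sex. -/
def IsMenageSeating (n : ℕ) (σ : Fin (2 * n) ≃ Fin n × Bool) : Prop :=
  ∀ i : Fin (2 * n),
    (σ i).1 ≠ (σ (finRotate (2 * n) i)).1 ∧ (σ i).2 ≠ (σ (finRotate (2 * n) i)).2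

/-- The menage number `M_n`. -/
def menageNumber (n : ℕ) : ℕ :=
  Nat.card {σ : Fin (2 * n) ≃ Fin n × Bool // IsMenageSeating n σ}

/-- The exponential generating function of the menage numbers. It has radius of convergence `0`
and is therefore a formal power series. -/
def menageEGF : ℝ⟦X⟧ :=
  PowerSeries.mk fun n => (menageNumber n : ℝ) / (n ! : ℝ)

/-- `λ₊(t)`, with the principal branch of the complex square root (`t² - 4t < 0` if
`0 < t < 4`). -/
def lambdaPlus (t : ℝ) : ℂ := ((t : ℂ) - 2 + Complex.sqrt ((t : ℂ) ^ 2 - 4 * (t : ℂ))) / 2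

/-- `λ₋(t)`. -/
def lambdaMinus (t : ℝ) : ℂ := ((t : ℂ) - 2 - Complex.sqrt ((t : ℂ) ^ 2 - 4 * (t : ℂ))) / 2

/-- The formal power series `(x² - 1) / (x t - (x + 1)²)` in `x`, for a real number `t`. -/
def formalKernel (t : ℝ) : ℝ⟦X⟧ :=
  (PowerSeries.X ^ 2 - 1) * (PowerSeries.X * PowerSeries.C t - (PowerSeries.X + 1) ^ 2)⁻¹

/-- `∫₀^∞ F(t) e^{-t} dt` for a family `F(t)` of formal power series in `x`: the integral is taken
coefficient by coefficient. -/
def formalLaplace (F : ℝ → ℝ⟦X⟧) : ℝ⟦X⟧ :=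
  PowerSeries.mk fun n => ∫ t in Set.Ioi (0 : ℝ), PowerSeries.coeff n (F t) * Real.exp (-t)

/-- The integral of `f` over `s` exists as a Cauchy principal value at `c`, and is `L`. -/
def HasPVIntegral (f : ℝ → ℝ) (s : Set ℝ) (c L : ℝ) : Prop :=
  (∀ ε > 0, IntegrableOn f (s \ Metric.ball c ε)) ∧
    Tendsto (fun ε : ℝ => ∫ t in s \ Metric.ball c ε, f t) (𝓝[>] 0) (𝓝 L)

/-- The exponential integral `Ei x`, for real `x ≠ 0`: the integral of `e^t / t` over `(-∞, x]`,
as a Cauchy principal value at `0` when `0 < x`. -/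
def expIntegralEi (x : ℝ) : ℝ :=
  limUnder (𝓝[>] (0 : ℝ)) fun ε : ℝ => ∫ t in Set.Iic x \ Metric.ball 0 ε, Real.exp t / t

/-- The function `((1 - x²) / x) e^{-(x+1)²/x} Ei((x+1)²/x)`. -/
def eiTerm (x : ℝ) : ℝ :=
  (1 - x ^ 2) / x * Real.exp (-((x + 1) ^ 2 / x)) * expIntegralEi ((x + 1) ^ 2 / x)

/-- `f` has the asymptotic expansion `A` (in the sense of Poincaré) as `x → 0`, `x ≠ 0`. -/
def HasAsymptoticExpansion (f : ℝ → ℝ) (A : ℝ⟦X⟧) : Prop :=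
  ∀ N : ℕ, (fun x : ℝ => f x - ∑ n ∈ Finset.range N, PowerSeries.coeff n A * x ^ n)
    =O[𝓝[≠] 0] fun x : ℝ => x ^ N

end

/-!
For `n > 0` a menage seating is determined by the sex on the even seats, the order `p` of the
persons there, and a permutation `π`, the order of the others being `p ∘ π`; the neighbours are not
spouses exactly if `π j ≠ j` and `π j ≠ j + 1` for all `j` modulo `n`. So `M_n = 2 n! U_n`, where
`U_n` is the number of these `π` (`menageNumber_eq_two_mul_factorial_mul`).

For `n > 1`, inclusion and exclusion writes `U_n` as a sum over the choices, for each `j`, of at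
most one of the forbidden values `j`, `j + 1`, no value being chosen twice. A choice at `k`
positions contributes `(-1)^k (n - k)!` (`card_isMenagePerm`). Since
`(n - k)! = ∫ t^(n-k) e^{-t} dt`, this is the Laplace integral of a sum over closed walks of length
`n` with three states, that is of the trace of the `n`-th power of a `3 × 3` transfer matrix. Its
eigenvalues are `0`, `λ₊(t)` and `λ₋(t)`, with `λ₊ + λ₋ = t - 2` and `λ₊ λ₋ = 1`, so the trace is
`λ₊^n + λ₋^n`, the Chebyshev polynomial `C_n` at `t - 2` (`menageNumber_eq_integral`).

The power series with these coefficients is `1 + (1 - x²) / (1 - (t - 2) x + x²)`, which gives (1),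
up to corrections in the degrees `0` and `1`. Expanding the kernel in powers of `t`, as a geometric
series in `t x / (1 + x)²`, and integrating gives (2).

For (3), the principal value of `e^t / t` exists since the singularity cancels to `2 sinh t / t` on
symmetric intervals, and the substitution `t ↦ (x + 1)² / x - t` carries the Laplace integral of
the kernel to `Ei` (`hasPVIntegral_menageKernel`). Repeated integration by parts gives
`Ei z ~ e^z ∑ k! / z^(k+1)` at both ends of the real line. At `z = (x + 1)² / x` this expansion,
cut off after `N` terms, is the sum in (2), cut off likewise, as a rational function of `x`; its
Taylor expansion agrees with the power series because asymptotic expansions respect sums, products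
and the inverse of `1 + x`.
-/

/-! ### Closed walks and traces of matrix powers -/

/-- The entries of a matrix power are sums over the walks `a, s 0, …, s (n - 1), b`. -/
theorem Matrix.pow_succ_apply_eq_sum_walks {ι R : Type*} [Fintype ι] [DecidableEq ι]
    [CommSemiring R] (A : Matrix ι ι R) (n : ℕ) (a b : ι) :
    (A ^ (n + 1)) a b =
      ∑ s : Fin n → ι, ∏ i : Fin (n + 1),
        A (Fin.cons (α := fun _ => ι) a s i) (Fin.snoc (α := fun _ => ι) s b i) := by
  induction n generalizing a with
  | zero =>
    simp [Fin.snoc]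
  | succ n ih =>
    rw [pow_succ', Matrix.mul_apply, ← (Fin.consEquiv fun _ : Fin (n + 1) => ι).sum_comp,
      Fintype.sum_prod_type]
    refine Finset.sum_congr rfl fun c _ => ?_
    rw [ih, Finset.mul_sum]
    refine Finset.sum_congr rfl fun s _ => ?_
    simp only [Fin.consEquiv, Equiv.coe_fn_mk, ← Fin.cons_snoc_eq_snoc_cons]
    rw [Fin.prod_univ_succ (n := n + 1)]
    simp only [Fin.cons_zero, Fin.cons_succ]

theorem Matrix.trace_pow_eq_sum_closed_walks {ι R : Type*} [Fintype ι] [DecidableEq ι]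
    [CommSemiring R] (A : Matrix ι ι R) {n : ℕ} (hn : n ≠ 0) :
    (A ^ n).trace = ∑ s : Fin n → ι, ∏ i, A (s i) (s (finRotate n i)) := by
  obtain ⟨n, rfl⟩ := Nat.exists_eq_succ_of_ne_zero hn
  rw [Nat.succ_eq_add_one, ← (Fin.consEquiv fun _ : Fin (n + 1) => ι).sum_comp,
    Fintype.sum_prod_type]
  refine Finset.sum_congr rfl fun a _ => ?_
  rw [Matrix.diag_apply, Matrix.pow_succ_apply_eq_sum_walks]
  refine Finset.sum_congr rfl fun s _ => ?_
  rw [Fin.snoc_eq_cons_rotate]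
  rfl

/-! ### Permutations with prescribed values -/

theorem card_perm_extending {α : Type*} [Fintype α] [DecidableEq α] (K : Finset α) (f : α → α)
    (hf : Set.InjOn f K) :
    Nat.card {π : Equiv.Perm α // ∀ i ∈ K, π i = f i} = (Fintype.card α - K.card)! := by
  -- One extension `ρ` of `f` reduces the count to that of the permutations fixing `K` pointwise.
  obtain ⟨ρ, hρ⟩ : ∃ ρ : Equiv.Perm α, ∀ i ∈ K, ρ i = f i := by
    obtain ⟨ρ, hρ⟩ := Equiv.Perm.exists_extending_pair (Subtype.val : K → α)
      (fun i : K => f i) Subtype.val_injective (fun a b h => Subtype.ext (hf a.2 b.2 h))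
    exact ⟨ρ, fun i hi => hρ ⟨i, hi⟩⟩
  have e : {π : Equiv.Perm α // ∀ i ∈ K, π i = f i} ≃
      {π : Equiv.Perm α // ∀ i, ¬ i ∉ K → π i = i} :=
    (Equiv.mulLeft ρ⁻¹).subtypeEquiv fun π => by
      simp only [Equiv.coe_mulLeft, Equiv.Perm.mul_apply, not_not]
      refine forall₂_congr fun i hi => ?_
      rw [Equiv.Perm.inv_eq_iff_eq, hρ i hi]
  rw [Nat.card_congr (e.trans (Equiv.Perm.subtypeEquivSubtypePerm fun i => i ∉ K).symm),
    Nat.card_eq_fintype_card, Fintype.card_perm, Fintype.card_subtype_compl]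
  simp

/-! ### Seatings and relative permutations -/

theorem val_finRotate {n : ℕ} (i : Fin n) : (finRotate n i : ℕ) = (i + 1) % n := by
  cases n with
  | zero => exact i.elim0
  | succ n => simp [Fin.val_add]

/-- `π j ∉ {j, j + 1}` for all `j` modulo `n`. -/
def IsMenagePerm {n : ℕ} (π : Equiv.Perm (Fin n)) : Prop :=
  ∀ j, π j ≠ j ∧ π j ≠ finRotate n j

/-- The `2n` seats as `n` consecutive pairs: seat `(j, b)` is seat `2j + b`. -/
def seatEquiv (n : ℕ) : Fin n × Bool ≃ Fin (2 * n) where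
  toFun x := ⟨2 * x.1 + x.2.toNat, by have := x.1.2; have := x.2.toNat_le; omega⟩
  invFun i := (⟨i / 2, by have := i.2; omega⟩, decide (i.1 % 2 = 1))
  left_inv := by
    rintro ⟨j, b⟩
    cases b <;> simp [Fin.ext_iff]
    omega
  right_inv i := by
    rcases Nat.mod_two_eq_zero_or_one i.1 with h | h
    · simp [Fin.ext_iff, h]
      omega
    · simp [Fin.ext_iff, h]
      omega

theorem finRotate_seatEquiv_false {n : ℕ} (j : Fin n) :
    finRotate (2 * n) (seatEquiv n (j, false)) = seatEquiv n (j, true) := by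
  have := j.2
  ext
  rw [val_finRotate]
  simp only [seatEquiv, Equiv.coe_fn_mk, Bool.toNat_false, Bool.toNat_true]
  exact Nat.mod_eq_of_lt (by omega)

theorem finRotate_seatEquiv_true {n : ℕ} (j : Fin n) :
    finRotate (2 * n) (seatEquiv n (j, true)) = seatEquiv n (finRotate n j, false) := by
  have := j.2
  ext
  rw [val_finRotate]
  simp only [seatEquiv, Equiv.coe_fn_mk, Bool.toNat_false, Bool.toNat_true, val_finRotate]
  rw [add_assoc, ← Nat.mul_mod_mul_left]
  rfl

theorem isMenageSeating_iff {n : ℕ} (σ : Fin (2 * n) ≃ Fin n × Bool) :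
    IsMenageSeating n σ ↔ ∀ j : Fin n,
      ((σ (seatEquiv n (j, false))).1 ≠ (σ (seatEquiv n (j, true))).1 ∧
        (σ (seatEquiv n (j, false))).2 ≠ (σ (seatEquiv n (j, true))).2) ∧
      ((σ (seatEquiv n (j, true))).1 ≠ (σ (seatEquiv n (finRotate n j, false))).1 ∧
        (σ (seatEquiv n (j, true))).2 ≠ (σ (seatEquiv n (finRotate n j, false))).2) := by
  rw [IsMenageSeating, ← (seatEquiv n).forall_congr_right]
  simp only [Prod.forall, Bool.forall_bool, finRotate_seatEquiv_false, finRotate_seatEquiv_true]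

/-- The seating in which the persons of sex `s` take the even seats, in the order `p`, and those
of the other sex take the odd seats, in the order `p ∘ π`. -/
def seatingOf {n : ℕ} (x : Bool × Equiv.Perm (Fin n) × Equiv.Perm (Fin n)) :
    Fin (2 * n) ≃ Fin n × Bool :=
  (seatEquiv n).symm.trans <|
    (Equiv.prodCongrLeft fun b : Bool => if b then x.2.2.trans x.2.1 else x.2.1).trans <|
      Equiv.prodCongrRight fun _ => Equiv.boolNot.permCongr <| if x.1 then Equiv.boolNot else
        Equiv.refl Bool

theorem seatingOf_apply {n : ℕ} (s : Bool) (p π : Equiv.Perm (Fin n)) (j : Fin n) (b : Bool) :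
    seatingOf (s, p, π) (seatEquiv n (j, b)) = (if b then p (π j) else p j, xor b s) := by
  cases b <;> cases s <;> simp [seatingOf]

theorem isMenageSeating_seatingOf {n : ℕ} (s : Bool) (p π : Equiv.Perm (Fin n)) :
    IsMenageSeating n (seatingOf (s, p, π)) ↔ IsMenagePerm π := by
  rw [isMenageSeating_iff]
  refine forall_congr' fun j => ?_
  simp only [seatingOf_apply]
  cases s <;> simp [eq_comm]

/-- In a menage seating all seats of the same parity are taken by persons of the same sex. -/
theorem IsMenageSeating.exists_eq_seatingOf {n : ℕ} (hn : n ≠ 0)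
    {σ : Fin (2 * n) ≃ Fin n × Bool} (h : IsMenageSeating n σ) :
    ∃ x, seatingOf x = σ := by
  rw [isMenageSeating_iff] at h
  have hn' : 0 < n := Nat.pos_of_ne_zero hn
  -- The sex on seat `0` propagates along the even seats, and the odd seats have the other one.
  obtain ⟨s, hs⟩ : ∃ s, s = (σ (seatEquiv n (⟨0, hn'⟩, false))).2 := ⟨_, rfl⟩
  have h0 : ∀ k (hk : k < n), (σ (seatEquiv n (⟨k, hk⟩, false))).2 = s := by
    intro k
    induction k with
    | zero => intro hk; rw [hs]
    | succ k ih =>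
      intro hk
      have h1 := (h ⟨k, by omega⟩).1.2
      have h2 := (h ⟨k, by omega⟩).2.2
      have h3 : finRotate n ⟨k, by omega⟩ = ⟨k + 1, hk⟩ := by
        ext
        rw [val_finRotate]
        exact Nat.mod_eq_of_lt hk
      rw [h3] at h2
      rw [ih] at h1
      revert h1 h2
      generalize (σ (seatEquiv n (⟨k, _⟩, true))).2 = u
      generalize (σ (seatEquiv n (⟨k + 1, _⟩, false))).2 = v
      cases s <;> cases u <;> cases v <;> simp
  have h2 : ∀ j b, (σ (seatEquiv n (j, b))).2 = xor b s := by
    intro j b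
    have h3 := h0 j j.2
    have h4 := (h j).1.2
    cases b
    · simpa using h3
    · rw [h3] at h4
      revert h4
      generalize (σ (seatEquiv n (j, true))).2 = u
      cases s <;> cases u <;> simp
  have hinj : ∀ b, Function.Injective fun j => (σ (seatEquiv n (j, b))).1 := by
    intro b i j hij
    have : σ (seatEquiv n (i, b)) = σ (seatEquiv n (j, b)) :=
      Prod.ext hij ((h2 i b).trans (h2 j b).symm)
    simpa using this
  let p : Bool → Equiv.Perm (Fin n) := fun b =>
    Equiv.ofBijective _ (Finite.injective_iff_bijective.1 (hinj b))
  have hp : ∀ b j, p b j = (σ (seatEquiv n (j, b))).1 := fun b j => rfl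
  refine ⟨(s, p false, (p true).trans (p false).symm), ?_⟩
  refine Equiv.ext ((seatEquiv n).forall_congr_right.1 ?_)
  rintro ⟨j, b⟩
  rw [seatingOf_apply]
  refine Prod.ext ?_ (h2 j b).symm
  cases b
  · simp [hp]
  · exact (p false).apply_symm_apply (p true j)

theorem menageNumber_eq_two_mul_factorial_mul {n : ℕ} (hn : n ≠ 0) :
    menageNumber n = 2 * n ! * Nat.card {π : Equiv.Perm (Fin n) // IsMenagePerm π} := by
  have hn' : 0 < n := Nat.pos_of_ne_zero hn
  let F : Bool × Equiv.Perm (Fin n) × {π : Equiv.Perm (Fin n) // IsMenagePerm π} →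
      {σ : Fin (2 * n) ≃ Fin n × Bool // IsMenageSeating n σ} := fun x =>
    ⟨seatingOf (x.1, x.2.1, x.2.2.1), (isMenageSeating_seatingOf _ _ _).2 x.2.2.2⟩
  have hF : Function.Bijective F := by
    constructor
    · rintro ⟨s, p, π, hπ⟩ ⟨s', p', π', hπ'⟩ hx
      have key : ∀ j b, (if b then p (π j) else p j, xor b s) =
          (if b then p' (π' j) else p' j, xor b s') := fun j b => by
        rw [← seatingOf_apply, ← seatingOf_apply]
        exact congrArg (fun y => y.1 (seatEquiv n (j, b))) hx
      obtain rfl : s = s' := by simpa using congrArg Prod.snd (key ⟨0, hn'⟩ false)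
      obtain rfl : p = p' := Equiv.ext fun j => by simpa using key j false
      obtain rfl : π = π' := Equiv.ext fun j => by simpa using key j true
      rfl
    · rintro ⟨σ, hσ⟩
      obtain ⟨⟨s, p, π⟩, rfl⟩ := hσ.exists_eq_seatingOf hn
      exact ⟨(s, p, ⟨π, (isMenageSeating_seatingOf _ _ _).1 hσ⟩), rfl⟩
  rw [menageNumber, ← Nat.card_congr (Equiv.ofBijective F hF)]
  simp [Nat.card_prod, Nat.card_eq_fintype_card, Fintype.card_perm, mul_assoc]

theorem menageNumber_zero : menageNumber 0 = 1 := by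
  rw [menageNumber, Nat.card_eq_one_iff_unique]
  exact ⟨⟨fun a b => Subtype.ext (Equiv.ext fun i => i.elim0)⟩,
    ⟨⟨(seatEquiv 0).symm, fun i => i.elim0⟩⟩⟩

theorem menageNumber_one : menageNumber 1 = 0 := by
  have : IsEmpty {π : Equiv.Perm (Fin 1) // IsMenagePerm π} :=
    ⟨fun π => (π.2 0).1 (Subsingleton.elim _ _)⟩
  rw [menageNumber_eq_two_mul_factorial_mul one_ne_zero, Nat.card_of_isEmpty, mul_zero]

/-! ### Inclusion and exclusion -/

/-- A function `s` encodes a choice of forbidden values: at `j` it chooses the value `j` if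
`s j = some false`, the value `j + 1` if `s j = some true`, and none if `s j = none`.
`forbiddenValue s j` is the value chosen at `j`; if there is none, it is `j`, which is not used. -/
def forbiddenValue {n : ℕ} (s : Fin n → Option Bool) (j : Fin n) : Fin n :=
  if s j = some true then finRotate n j else j

/-- The set of positions at which a forbidden value is chosen. -/
def chosenPositions {n : ℕ} (s : Fin n → Option Bool) : Finset (Fin n) :=
  {j | s j ≠ none}

/-- No value is chosen twice, because `j + 1` at `j` and `j + 1` at `j + 1` exclude each other. -/
def IsCompatibleChoice {n : ℕ} (s : Fin n → Option Bool) : Prop :=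
  ∀ j, ¬ (s j = some true ∧ s (finRotate n j) = some false)

theorem finRotate_ne_self {n : ℕ} (hn : 1 < n) (i : Fin n) : finRotate n i ≠ i := by
  intro h
  have h1 := congrArg Fin.val h
  rw [val_finRotate] at h1
  have := i.2
  rcases Nat.lt_or_ge (i + 1) n with h2 | h2
  · rw [Nat.mod_eq_of_lt h2] at h1; omega
  · have : (i : ℕ) + 1 = n := by omega
    rw [this, Nat.mod_self] at h1
    omega

theorem injOn_forbiddenValue_iff {n : ℕ} (hn : 1 < n) (s : Fin n → Option Bool) :
    Set.InjOn (forbiddenValue s) (chosenPositions s) ↔ IsCompatibleChoice s := by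
  constructor
  · rintro h j ⟨h1, h2⟩
    have h3 := @h (finRotate n j) (by simp [chosenPositions, h2, -finRotate_apply]) j
      (by simp [chosenPositions, h1]) (by simp [forbiddenValue, h1, h2, -finRotate_apply])
    exact finRotate_ne_self hn j h3
  · intro h i hi j hj hij
    simp only [chosenPositions, Finset.coe_filter, Finset.mem_univ, true_and,
      Set.mem_ofPred_eq] at hi hj
    simp only [forbiddenValue] at hij
    have hi' : s i ≠ some true → s i = some false := by
      rcases h1 : s i with _ | _ | _ <;> simp_all
    have hj' : s j ≠ some true → s j = some false := by
      rcases h1 : s j with _ | _ | _ <;> simp_all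
    split_ifs at hij with h1 h2 h2
    · exact (finRotate n).injective hij
    · exact absurd ⟨h1, hij ▸ hj' h2⟩ (h i)
    · exact absurd ⟨h2, hij ▸ hi' h1⟩ (h j)
    · exact hij

open Classical in
/-- Inclusion and exclusion over the sets of conditions `π j = j` and `π j = j + 1`: for `n > 1`
the two conditions at one position exclude each other, so that a set of conditions that can hold
is a choice of at most one condition at each position. -/
theorem card_isMenagePerm {n : ℕ} (hn : 1 < n) :
    (Nat.card {π : Equiv.Perm (Fin n) // IsMenagePerm π} : ℝ) =
      ∑ s : Fin n → Option Bool, if IsCompatibleChoice s then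
        (-1) ^ (chosenPositions s).card * ((n - (chosenPositions s).card)! : ℝ) else 0 := by
  -- The indicator of the menage permutations is `∏ⱼ (1 - [π j = j] - [π j = j + 1])`.
  have h1 : ∀ π : Equiv.Perm (Fin n), (if IsMenagePerm π then (1 : ℝ) else 0) =
      ∏ j, ∑ o : Option Bool, (o.elim 1 fun b =>
        if π j = (if b then finRotate n j else j) then (-1 : ℝ) else 0) := by
    intro π
    have : ∀ j, ∑ o : Option Bool, (o.elim 1 fun b =>
        if π j = (if b then finRotate n j else j) then (-1 : ℝ) else 0) =
        if π j ≠ j ∧ π j ≠ finRotate n j then 1 else 0 := by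
      intro j
      have hj := finRotate_ne_self hn j
      by_cases ha : π j = j
      · simp [Fintype.sum_option, ha, hj.symm, -finRotate_apply]
      · by_cases hb : π j = finRotate n j
        · simp [Fintype.sum_option, hb, hj, -finRotate_apply]
        · simp [Fintype.sum_option, ha, hb, -finRotate_apply]
    simp only [this, Finset.prod_ite_zero, Finset.prod_const_one, Finset.mem_univ, true_implies]
    exact if_congr Iff.rfl rfl rfl
  have h2 : ∀ (s : Fin n → Option Bool) (π : Equiv.Perm (Fin n)),
      ∏ j, ((s j).elim 1 fun b =>
        if π j = (if b then finRotate n j else j) then (-1 : ℝ) else 0) =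
      if ∀ j ∈ chosenPositions s, π j = forbiddenValue s j then
        (-1) ^ (chosenPositions s).card else 0 := by
    intro s π
    have h := Finset.prod_ite_zero (s := chosenPositions s)
      (p := fun j => π j = forbiddenValue s j) (f := fun _ => (-1 : ℝ))
    rw [Finset.prod_const] at h
    refine Eq.trans ?_ (h.trans (by congr))
    rw [chosenPositions, Finset.prod_filter]
    refine Finset.prod_congr rfl fun j _ => ?_
    rcases h : s j with _ | _ | _ <;> simp [forbiddenValue, h]
  have h3 : (Nat.card {π : Equiv.Perm (Fin n) // IsMenagePerm π} : ℝ) =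
      ∑ π : Equiv.Perm (Fin n), if IsMenagePerm π then (1 : ℝ) else 0 := by
    rw [Nat.card_eq_fintype_card, Fintype.card_subtype, Finset.sum_boole]
  rw [h3]
  simp only [h1, Fintype.prod_sum]
  rw [Finset.sum_comm]
  refine Finset.sum_congr rfl fun s _ => ?_
  simp only [h2]
  rw [← Finset.sum_filter, Finset.sum_const, nsmul_eq_mul, mul_comm, ← Fintype.card_subtype,
    ← Nat.card_eq_fintype_card]
  split_ifs with hs
  · rw [card_perm_extending _ _ ((injOn_forbiddenValue_iff hn s).2 hs), Fintype.card_fin]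
  · rw [← injOn_forbiddenValue_iff hn s] at hs
    have : IsEmpty {π : Equiv.Perm (Fin n) //
        ∀ j ∈ chosenPositions s, π j = forbiddenValue s j} :=
      ⟨fun π => hs fun i hi j hj hij => π.1.injective <| by
        rw [π.2 i hi, π.2 j hj, hij]⟩
    rw [Nat.card_of_isEmpty, Nat.cast_zero, mul_zero]

/-! ### Laplace integrals of polynomials -/

theorem integrableOn_pow_mul_exp_neg (k : ℕ) :
    IntegrableOn (fun t : ℝ => t ^ k * Real.exp (-t)) (Set.Ioi 0) := by
  refine (Real.GammaIntegral_convergent (s := k + 1) (by positivity)).congr_fun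
    (fun t _ => ?_) measurableSet_Ioi
  simp [mul_comm]

theorem integral_pow_mul_exp_neg (k : ℕ) :
    ∫ t in Set.Ioi (0 : ℝ), t ^ k * Real.exp (-t) = k ! := by
  rw [← Real.Gamma_nat_eq_factorial, Real.Gamma_eq_integral (by positivity)]
  refine setIntegral_congr_fun measurableSet_Ioi fun t _ => ?_
  simp [mul_comm]

theorem integrableOn_eval_mul_exp_neg (p : Polynomial ℝ) :
    IntegrableOn (fun t : ℝ => p.eval t * Real.exp (-t)) (Set.Ioi 0) := by
  simp only [Polynomial.eval_eq_sum_range, Finset.sum_mul, mul_assoc]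
  exact integrable_finsetSum _ fun k _ => (integrableOn_pow_mul_exp_neg k).const_mul _

/-! ### The transfer matrix -/

/-- The transfer matrix for compatible choices of forbidden values: the row is the choice at `j`,
weighted by `t` if it is empty and by `-1` otherwise, and the column is the choice at `j + 1`. -/
def menageTransfer (t : ℝ) : Matrix (Option Bool) (Option Bool) ℝ := fun a b =>
  if a = some true ∧ b = some false then 0 else a.elim t fun _ => -1

/-- The polynomial `C_n(t - 2)`, where `C_n(y + y⁻¹) = yⁿ + y⁻ⁿ`. -/
noncomputable def menagePoly (n : ℕ) : Polynomial ℝ :=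
  (Polynomial.Chebyshev.C ℝ n).comp (Polynomial.X - 2)

theorem menagePoly_zero : menagePoly 0 = 2 := by
  simp [menagePoly]

theorem menagePoly_one : menagePoly 1 = Polynomial.X - 2 := by
  simp [menagePoly]

theorem menagePoly_add_two (n : ℕ) :
    menagePoly (n + 2) = (Polynomial.X - 2) * menagePoly (n + 1) - menagePoly n := by
  simp only [menagePoly]
  push_cast
  rw [Polynomial.Chebyshev.C_add_two]
  simp

/-- The characteristic polynomial of the transfer matrix is `X (X² - (t - 2) X + 1)`. -/
theorem menageTransfer_pow_three (t : ℝ) :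
    menageTransfer t ^ 3 = (t - 2) • menageTransfer t ^ 2 - menageTransfer t := by
  ext a b
  rcases a with _ | _ | _ <;> rcases b with _ | _ | _ <;>
    simp [pow_succ, Matrix.mul_apply, Fintype.sum_option, menageTransfer] <;> ring

theorem trace_menageTransfer_pow (t : ℝ) {n : ℕ} (hn : n ≠ 0) :
    (menageTransfer t ^ n).trace = (menagePoly n).eval t := by
  obtain ⟨n, rfl⟩ := Nat.exists_eq_succ_of_ne_zero hn
  clear hn
  induction n using Nat.twoStepInduction with
  | zero =>
    simp [menagePoly_one, Matrix.trace, Fintype.sum_option, menageTransfer]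
    ring
  | one =>
    rw [show Nat.succ 1 = 0 + 2 from rfl, menagePoly_add_two, menagePoly_zero, menagePoly_one]
    simp [pow_succ, Matrix.mul_apply, Matrix.trace, Fintype.sum_option, menageTransfer]
    ring
  | more n h1 h2 =>
    have h : menageTransfer t ^ (n + 3) =
        (t - 2) • menageTransfer t ^ (n + 2) - menageTransfer t ^ (n + 1) := by
      rw [pow_add, menageTransfer_pow_three, mul_sub, Algebra.mul_smul_comm, ← pow_add,
        ← pow_succ]
    simp only [Nat.succ_eq_add_one, add_assoc, Nat.reduceAdd] at h1 h2 ⊢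
    rw [h, Matrix.trace_sub, Matrix.trace_smul, h1, h2, show n + 3 = n + 1 + 2 from rfl,
      menagePoly_add_two (n + 1)]
    simp

open Classical in
/-- The weight of a closed walk: it vanishes unless the choice is compatible. -/
theorem prod_menageTransfer (t : ℝ) {n : ℕ} (s : Fin n → Option Bool) :
    ∏ j, menageTransfer t (s j) (s (finRotate n j)) =
      if IsCompatibleChoice s then
        (-1) ^ (chosenPositions s).card * t ^ (n - (chosenPositions s).card) else 0 := by
  have h1 : ∀ j, menageTransfer t (s j) (s (finRotate n j)) =
      if ¬ (s j = some true ∧ s (finRotate n j) = some false) then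
        (if j ∈ chosenPositions s then -1 else t) else 0 := by
    intro j
    simp only [menageTransfer, chosenPositions, Finset.mem_filter_univ]
    rcases s j with _ | _ | _ <;> simp
  have h2 : n - (chosenPositions s).card = (Finset.univ \ chosenPositions s).card := by
    rw [Finset.card_sdiff_of_subset (Finset.subset_univ _), Finset.card_univ, Fintype.card_fin]
  simp only [h1, Finset.prod_ite_zero, Finset.mem_univ, true_implies]
  refine if_congr Iff.rfl ?_ rfl
  rw [Finset.prod_ite, Finset.prod_const, Finset.prod_const, h2]
  congr 3 <;> ext <;> simp

theorem menageNumber_eq_integral {n : ℕ} (hn : 1 < n) :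
    (menageNumber n : ℝ) =
      2 * n ! * ∫ t in Set.Ioi (0 : ℝ), (menagePoly n).eval t * Real.exp (-t) := by
  classical
  have hn0 : n ≠ 0 := by omega
  rw [menageNumber_eq_two_mul_factorial_mul hn0]
  push_cast
  rw [card_isMenagePerm hn]
  congr 1
  simp only [← trace_menageTransfer_pow _ hn0, Matrix.trace_pow_eq_sum_closed_walks _ hn0,
    prod_menageTransfer, Finset.sum_mul]
  have h : ∀ (s : Fin n → Option Bool) (t : ℝ),
      (if IsCompatibleChoice s then
        (-1) ^ (chosenPositions s).card * t ^ (n - (chosenPositions s).card) else 0) *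
          Real.exp (-t) =
      (if IsCompatibleChoice s then (-1) ^ (chosenPositions s).card else 0) *
        (t ^ (n - (chosenPositions s).card) * Real.exp (-t)) := fun s t => by
    split_ifs <;> ring
  simp only [h]
  rw [integral_finsetSum _ fun s _ => (integrableOn_pow_mul_exp_neg _).const_mul _]
  refine Finset.sum_congr rfl fun s _ => ?_
  rw [integral_const_mul, integral_pow_mul_exp_neg]
  have : (chosenPositions s).card ≤ n := by simpa using (chosenPositions s).card_le_univ
  split_ifs <;> simp

theorem lambdaPlus_add_lambdaMinus (t : ℝ) : lambdaPlus t + lambdaMinus t = t - 2 := by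
  simp only [lambdaPlus, lambdaMinus]
  ring

theorem lambdaPlus_mul_lambdaMinus (t : ℝ) : lambdaPlus t * lambdaMinus t = 1 := by
  have h : Complex.sqrt ((t : ℂ) ^ 2 - 4 * (t : ℂ)) ^ 2 = (t : ℂ) ^ 2 - 4 * (t : ℂ) := by
    rw [Complex.sqrt, Complex.cpow_ofNat_inv_pow]
  simp only [lambdaPlus, lambdaMinus]
  linear_combination (-1 / 4 : ℂ) * h

theorem lambdaPlus_pow_add_lambdaMinus_pow (t : ℝ) (n : ℕ) :
    lambdaPlus t ^ n + lambdaMinus t ^ n = (((menagePoly n).eval t : ℝ) : ℂ) := by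
  induction n using Nat.twoStepInduction with
  | zero => simp [menagePoly_zero]; norm_num
  | one => simp [menagePoly_one, lambdaPlus_add_lambdaMinus]
  | more n h1 h2 =>
    rw [menagePoly_add_two]
    simp only [Polynomial.eval_sub, Polynomial.eval_mul, Polynomial.eval_X,
      Polynomial.eval_ofNat, Complex.ofReal_sub, Complex.ofReal_mul, Complex.ofReal_ofNat]
    rw [← h1, ← h2, ← lambdaPlus_add_lambdaMinus]
    linear_combination (-(lambdaPlus t ^ n) - lambdaMinus t ^ n) * lambdaPlus_mul_lambdaMinus t

/-! ### The generating function as a formal power series -/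

theorem formalKernel_mul_one_sub_C_mul_X_add_X_sq (t : ℝ) :
    formalKernel t * (1 - PowerSeries.C (t - 2) * PowerSeries.X + PowerSeries.X ^ 2) =
      1 - PowerSeries.X ^ 2 := by
  have h : (PowerSeries.X * PowerSeries.C t - (PowerSeries.X + 1) ^ 2 : ℝ⟦X⟧)⁻¹ *
      (PowerSeries.X * PowerSeries.C t - (PowerSeries.X + 1) ^ 2) = 1 :=
    PowerSeries.inv_mul_cancel _ (by simp)
  rw [formalKernel, map_sub, map_ofNat]
  linear_combination (1 - PowerSeries.X ^ 2) * h

/-- `∑ C_n(y) xⁿ = (2 - y x) / (1 - y x + x²)`, with `y = t - 2` and `1` subtracted. -/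
theorem mk_menagePoly_mul (t : ℝ) :
    (PowerSeries.mk (fun n => (menagePoly n).eval t) - 1) *
        (1 - PowerSeries.C (t - 2) * PowerSeries.X + PowerSeries.X ^ 2) =
      1 - PowerSeries.X ^ 2 := by
  have h : PowerSeries.mk (fun n => (menagePoly n).eval t) *
      (1 - PowerSeries.C (t - 2) * PowerSeries.X + PowerSeries.X ^ 2) =
      2 - PowerSeries.C (t - 2) * PowerSeries.X := by
    ext n
    rw [show (2 : ℝ⟦X⟧) = PowerSeries.C 2 from (map_ofNat _ 2).symm, mul_add, mul_sub, mul_one,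
      mul_left_comm]
    obtain ⟨y, hy⟩ : ∃ y, y = t - 2 := ⟨_, rfl⟩
    rw [← hy]
    rcases n with _ | _ | n
    · simp [menagePoly_zero]
    · simp [menagePoly_zero, menagePoly_one, PowerSeries.coeff_C_mul, PowerSeries.coeff_mul_X_pow',
        PowerSeries.coeff_C, PowerSeries.coeff_succ_mul_X, ← hy]
      ring
    · simp [menagePoly_add_two, PowerSeries.coeff_mul_X_pow', PowerSeries.coeff_C_mul,
        PowerSeries.coeff_succ_mul_X, ← hy]
  linear_combination h

theorem coeff_formalKernel (t : ℝ) (n : ℕ) :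
    PowerSeries.coeff n (formalKernel t) = if n = 0 then 1 else (menagePoly n).eval t := by
  have h : formalKernel t = PowerSeries.mk (fun n => (menagePoly n).eval t) - 1 := by
    refine mul_right_cancel₀ (b := 1 - PowerSeries.C (t - 2) * PowerSeries.X +
      PowerSeries.X ^ 2) ?_
      ((formalKernel_mul_one_sub_C_mul_X_add_X_sq t).trans (mk_menagePoly_mul t).symm)
    intro h
    simpa using congrArg PowerSeries.constantCoeff h
  rw [h, map_sub, PowerSeries.coeff_mk, PowerSeries.coeff_one]
  split_ifs with hn
  · rw [hn, menagePoly_zero]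
    norm_num
  · ring

theorem integrableOn_coeff_formalKernel (n : ℕ) :
    IntegrableOn (fun t : ℝ => PowerSeries.coeff n (formalKernel t) * Real.exp (-t))
      (Set.Ioi 0) := by
  simp only [coeff_formalKernel]
  split_ifs
  · simpa using integrableOn_pow_mul_exp_neg 0
  · exact integrableOn_eval_mul_exp_neg _

theorem menageEGF_eq_formalLaplace :
    menageEGF = -1 + 2 * PowerSeries.X + 2 * formalLaplace formalKernel := by
  ext n
  have h2 : (2 : ℝ⟦X⟧) = PowerSeries.C 2 := (map_ofNat _ 2).symm
  have h0 := integral_pow_mul_exp_neg 0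
  simp only [pow_zero, one_mul, Nat.factorial_zero, Nat.cast_one] at h0
  simp only [menageEGF, formalLaplace, h2, map_add, map_neg, PowerSeries.coeff_C_mul,
    PowerSeries.coeff_mk, PowerSeries.coeff_one, PowerSeries.coeff_X, coeff_formalKernel]
  -- The integral formula fails for `n = 0` and `n = 1`; the terms `-1 + 2 x` make up for this.
  rcases n with _ | _ | n
  · simp [menageNumber_zero, h0]
    norm_num
  · have h1 := integral_pow_mul_exp_neg 1
    have h3 : ∫ t in Set.Ioi (0 : ℝ), (t - 2) * Real.exp (-t) = -1 := by
      simp only [sub_mul]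
      rw [integral_sub (by simpa [IntegrableOn] using integrableOn_pow_mul_exp_neg 1)
        (by simpa [IntegrableOn] using (integrableOn_pow_mul_exp_neg 0).const_mul 2),
        integral_const_mul, h0]
      simp only [pow_one, Nat.factorial_one, Nat.cast_one] at h1
      rw [h1]
      norm_num
    simp [menageNumber_one, menagePoly_one, h3]
  · have hf : ((n + 1 + 1)! : ℝ) ≠ 0 := by positivity
    rw [menageNumber_eq_integral (by omega)]
    simp
    field_simp

/-- The power series of `x / (1 + x)²`. -/
noncomputable def koebeSeries : ℝ⟦X⟧ :=
  PowerSeries.X * (1 + PowerSeries.X)⁻¹ ^ 2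

theorem one_add_X_mul_inv : (1 + PowerSeries.X : ℝ⟦X⟧) * (1 + PowerSeries.X)⁻¹ = 1 :=
  PowerSeries.mul_inv_cancel _ (by simp)

theorem X_pow_mul_inv_one_add_X_pow (k : ℕ) :
    (PowerSeries.X ^ k * ((1 + PowerSeries.X) ^ (2 * k))⁻¹ : ℝ⟦X⟧) = koebeSeries ^ k := by
  have h : ((1 + PowerSeries.X) ^ (2 * k) : ℝ⟦X⟧)⁻¹ = (1 + PowerSeries.X)⁻¹ ^ (2 * k) := by
    rw [PowerSeries.inv_eq_iff_mul_eq_one (by simp), ← mul_pow, mul_comm, one_add_X_mul_inv,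
      one_pow]
  rw [h, koebeSeries, mul_pow, ← pow_mul]

theorem coeff_mul_koebeSeries_pow_of_lt (A : ℝ⟦X⟧) {n k : ℕ} (h : n < k) :
    PowerSeries.coeff n (A * koebeSeries ^ k) = 0 := by
  refine PowerSeries.X_pow_dvd_iff.1 (Dvd.dvd.mul_left ?_ A) n h
  rw [koebeSeries, mul_pow]
  exact dvd_mul_right _ _

/-- The kernel is `(1 - x) / (1 + x) * ∑ₖ tᵏ (x / (1 + x)²)ᵏ`. -/
theorem coeff_formalKernel_eq_sum (t : ℝ) {n N : ℕ} (h : n < N) :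
    PowerSeries.coeff n (formalKernel t) = ∑ k ∈ Finset.range N, t ^ k *
      PowerSeries.coeff n ((1 - PowerSeries.X) * (1 + PowerSeries.X)⁻¹ * koebeSeries ^ k) := by
  set D : ℝ⟦X⟧ := (1 - PowerSeries.X) * (1 + PowerSeries.X)⁻¹ with hD
  set w : ℝ⟦X⟧ := PowerSeries.C t * koebeSeries with hw
  have h1 : formalKernel t * (1 - w) = D := by
    have h2 := formalKernel_mul_one_sub_C_mul_X_add_X_sq t
    rw [map_sub, map_ofNat] at h2
    rw [hw, hD, koebeSeries]
    set I : ℝ⟦X⟧ := (1 + PowerSeries.X)⁻¹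
    have h3 : (1 + PowerSeries.X : ℝ⟦X⟧) * I = 1 := one_add_X_mul_inv
    linear_combination I ^ 2 * h2 + (1 - PowerSeries.X) * I * h3 -
      formalKernel t * ((1 + PowerSeries.X) * I + 1) * h3
  have h2 : formalKernel t = formalKernel t * w ^ N + ∑ k ∈ Finset.range N, D * w ^ k := by
    rw [← Finset.mul_sum, ← h1, mul_assoc, mul_neg_geom_sum]
    ring
  have h3 : formalKernel t * w ^ N =
      formalKernel t * PowerSeries.C t ^ N * koebeSeries ^ N := by
    rw [hw, mul_pow, mul_assoc]
  rw [h2, map_add, h3, coeff_mul_koebeSeries_pow_of_lt _ h, zero_add, map_sum]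
  refine Finset.sum_congr rfl fun k _ => ?_
  rw [hw, mul_pow, mul_left_comm, ← map_pow, PowerSeries.coeff_C_mul]

/-- Modulo `x ^ N`, the first `N` terms of the factorial series suffice. -/
theorem coeff_formalLaplace_formalKernel {n N : ℕ} (h : n < N) :
    PowerSeries.coeff n (formalLaplace formalKernel) =
      ∑ k ∈ Finset.range N, PowerSeries.coeff n ((1 - PowerSeries.X) * (1 + PowerSeries.X)⁻¹ *
        (PowerSeries.C (k ! : ℝ) * koebeSeries ^ k)) := by
  rw [formalLaplace, PowerSeries.coeff_mk]
  simp only [coeff_formalKernel_eq_sum _ h, Finset.sum_mul, mul_right_comm _ _ (Real.exp _)]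
  rw [integral_finsetSum _ fun k _ => (integrableOn_pow_mul_exp_neg k).mul_const _]
  refine Finset.sum_congr rfl fun k _ => ?_
  rw [integral_mul_const, integral_pow_mul_exp_neg, mul_left_comm, PowerSeries.coeff_C_mul]

theorem summable_factorial_mul_koebeSeries_pow :
    Summable fun k : ℕ => PowerSeries.C (k ! : ℝ) * koebeSeries ^ k := by
  refine PowerSeries.WithPiTopology.summable_iff_summable_coeff _ |>.2 fun n => ?_
  refine summable_of_hasFiniteSupport ((Set.finite_Iic n).subset ?_)
  simp_rw [Function.support_subset_iff, Set.mem_Iic]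
  intro k hk
  contrapose! hk
  exact coeff_mul_koebeSeries_pow_of_lt _ hk

theorem formalLaplace_formalKernel_eq_tsum :
    formalLaplace formalKernel = (1 - PowerSeries.X) * (1 + PowerSeries.X)⁻¹ *
      ∑' k : ℕ, PowerSeries.C (k ! : ℝ) * koebeSeries ^ k := by
  ext n
  have h := summable_factorial_mul_koebeSeries_pow
  rw [← h.tsum_mul_left, coeff_formalLaplace_formalKernel n.lt_succ_self,
    ← (PowerSeries.WithPiTopology.hasSum_iff_hasSum_coeff _ |>.1 (h.mul_left _).hasSum n).tsum_eq]
  refine (tsum_eq_sum fun k hk => ?_).symm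
  rw [← mul_assoc]
  exact coeff_mul_koebeSeries_pow_of_lt _ (by simpa using hk)

/-! ### Principal value integrals -/

theorem HasPVIntegral.const_mul {f : ℝ → ℝ} {s : Set ℝ} {c L : ℝ} (h : HasPVIntegral f s c L)
    (K : ℝ) : HasPVIntegral (fun t => K * f t) s c (K * L) := by
  refine ⟨fun ε hε => (h.1 ε hε).const_mul K, ?_⟩
  simp only [integral_const_mul]
  exact h.2.const_mul K

/-- If `c` is not in the closure of `s`, the principal value is an ordinary integral. -/
theorem HasPVIntegral.integrableOn_and_integral_eq {f : ℝ → ℝ} {s : Set ℝ} {c L : ℝ}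
    (h : HasPVIntegral f s c L) {r : ℝ} (hr : 0 < r) (hs : Disjoint s (Metric.ball c r)) :
    IntegrableOn f s ∧ ∫ t in s, f t = L := by
  refine ⟨by simpa [hs.sdiff_eq_left] using h.1 r hr, ?_⟩
  refine tendsto_nhds_unique (tendsto_const_nhds.congr' ?_) h.2
  filter_upwards [Ioo_mem_nhdsGT hr] with ε hε
  rw [(hs.mono_right (Metric.ball_subset_ball hε.2.le)).sdiff_eq_left]

theorem HasPVIntegral.of_integrableOn {f : ℝ → ℝ} {s : Set ℝ} {c : ℝ} (h : IntegrableOn f s)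
    {r : ℝ} (hr : 0 < r) (hs : Disjoint s (Metric.ball c r)) :
    HasPVIntegral f s c (∫ t in s, f t) := by
  refine ⟨fun ε _ => h.mono_set Set.sdiff_subset, tendsto_const_nhds.congr' ?_⟩
  filter_upwards [Ioo_mem_nhdsGT hr] with ε hε
  rw [(hs.mono_right (Metric.ball_subset_ball hε.2.le)).sdiff_eq_left]

theorem HasPVIntegral.union {f : ℝ → ℝ} {s u : Set ℝ} {c L M : ℝ} (h : HasPVIntegral f s c L)
    (hu : HasPVIntegral f u c M) (hm : MeasurableSet u) (hsu : Disjoint s u) :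
    HasPVIntegral f (s ∪ u) c (L + M) := by
  refine ⟨fun ε hε => ?_, (h.2.add hu.2).congr' ?_⟩
  · rw [Set.union_sdiff_distrib]
    exact (h.1 ε hε).union (hu.1 ε hε)
  · filter_upwards [self_mem_nhdsWithin] with ε hε
    rw [Set.union_sdiff_distrib, setIntegral_union (hsu.mono Set.sdiff_subset Set.sdiff_subset)
      (hm.diff Metric.isOpen_ball.measurableSet) (h.1 ε hε) (hu.1 ε hε)]

/-- The substitution `u = c - t` carries `(-∞, c]` to `[0, ∞)` and the singularity `0` to `c`. -/
theorem HasPVIntegral.comp_sub_left {f : ℝ → ℝ} {c L : ℝ}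
    (h : HasPVIntegral f (Set.Iic c) 0 L) :
    HasPVIntegral (fun t => f (c - t)) (Set.Ioi 0) c L := by
  have hmp : MeasurePreserving (fun t : ℝ => c - t) volume volume :=
    Measure.measurePreserving_sub_left volume c
  have hemb : MeasurableEmbedding fun t : ℝ => c - t :=
    (MeasurableEquiv.subLeft c).measurableEmbedding
  have hset : ∀ ε : ℝ, (fun t : ℝ => c - t) ⁻¹' (Set.Iic c \ Metric.ball 0 ε) =
      Set.Ici 0 \ Metric.ball c ε := by
    intro ε
    ext t
    simp [Real.dist_eq, abs_sub_comm c t]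
  have hae : ∀ ε : ℝ, (Set.Ioi 0 \ Metric.ball c ε : Set ℝ) =ᵐ[volume]
      (Set.Ici 0 \ Metric.ball c ε : Set ℝ) := fun ε =>
    ae_eq_set_sdiff Ioi_ae_eq_Ici (ae_eq_refl _)
  constructor
  · intro ε hε
    rw [integrableOn_congr_set_ae (hae ε), ← hset]
    exact (hmp.integrableOn_comp_preimage hemb).2 (h.1 ε hε)
  · refine h.2.congr fun ε => ?_
    rw [setIntegral_congr_set (hae ε), ← hset, hmp.setIntegral_preimage_emb hemb]

/-! ### The exponential integral -/

theorem integrableOn_exp_div_diff_ball (z : ℝ) {ε : ℝ} (hε : 0 < ε) :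
    IntegrableOn (fun t : ℝ => Real.exp t / t) (Set.Iic z \ Metric.ball 0 ε) := by
  have hm : MeasurableSet (Set.Iic z \ Metric.ball (0 : ℝ) ε) :=
    measurableSet_Iic.diff Metric.isOpen_ball.measurableSet
  refine Integrable.mono' (((integrableOn_exp_Iic z).mono_set Set.sdiff_subset).div_const ε)
    (Real.measurable_exp.div measurable_id).aestronglyMeasurable ?_
  refine (ae_restrict_iff' hm).2 (ae_of_all _ fun t ht => ?_)
  have h2 : ε ≤ |t| := by simpa using ht.2
  rw [norm_div, Real.norm_eq_abs, Real.norm_eq_abs, Real.abs_exp]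
  gcongr

theorem continuousOn_exp_mul_inv_pow (m : ℕ) :
    ContinuousOn (fun t : ℝ => Real.exp t * t⁻¹ ^ m) {0}ᶜ :=
  Real.continuous_exp.continuousOn.mul (continuousOn_inv₀.pow m)

theorem continuousOn_exp_div : ContinuousOn (fun t : ℝ => Real.exp t / t) {0}ᶜ := by
  simpa [div_eq_mul_inv] using continuousOn_exp_mul_inv_pow 1

/-- On an interval symmetric about `0`, adding the values at `t` and `-t` cancels the singularity
of `e^t / t` and leaves `2 sinh t / t`, whose continuous extension is twice the slope of
`sinh` at `0`. -/
theorem hasPVIntegral_exp_div_Ioc {z : ℝ} (hz : 0 < z) :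
    ∃ L, HasPVIntegral (fun t : ℝ => Real.exp t / t) (Set.Ioc (-z) z) 0 L := by
  have hint : ∀ ε : ℝ, 0 < ε → IntegrableOn (fun t : ℝ => Real.exp t / t)
      (Set.Ioc (-z) z \ Metric.ball 0 ε) := fun ε hε =>
    (integrableOn_exp_div_diff_ball z hε).mono_set
      (Set.sdiff_subset_sdiff_left Set.Ioc_subset_Iic_self)
  have hcont : Continuous fun t : ℝ => 2 * dslope Real.sinh 0 t := by
    have h := (continuousOn_dslope (f := Real.sinh) (a := 0) Filter.univ_mem).2
      ⟨Real.continuous_sinh.continuousOn, Real.differentiable_sinh 0⟩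
    exact (continuousOn_univ.1 h).const_mul 2
  refine ⟨∫ t in (0 : ℝ)..z, 2 * dslope Real.sinh 0 t, hint, ?_⟩
  have hlim : Tendsto (fun ε : ℝ => ∫ t in ε..z, 2 * dslope Real.sinh 0 t) (𝓝[>] 0)
      (𝓝 (∫ t in (0 : ℝ)..z, 2 * dslope Real.sinh 0 t)) := by
    have h : Continuous fun ε : ℝ => ∫ t in z..ε, 2 * dslope Real.sinh 0 t :=
      intervalIntegral.continuous_primitive (fun a b => hcont.intervalIntegrable a b) z
    simp only [intervalIntegral.integral_symm z]
    exact (h.neg.tendsto 0).mono_left nhdsWithin_le_nhds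
  refine hlim.congr' ?_
  filter_upwards [Ioo_mem_nhdsGT hz] with ε hε
  have hset : Set.Ioc (-z) z \ Metric.ball 0 ε = Set.Ioc (-z) (-ε) ∪ Set.Icc ε z := by
    ext t
    simp only [Set.mem_sdiff, Set.mem_Ioc, Metric.mem_ball, Real.dist_eq, sub_zero, not_lt,
      le_abs, Set.mem_union, Set.mem_Icc]
    have h1 := hε.1
    have h2 := hε.2
    constructor
    · rintro ⟨⟨h3, h4⟩, h5 | h5⟩
      · exact Or.inr ⟨h5, h4⟩
      · exact Or.inl ⟨h3, by linarith⟩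
    · rintro (⟨h3, h4⟩ | ⟨h3, h4⟩)
      · exact ⟨⟨h3, by linarith⟩, Or.inr (by linarith)⟩
      · exact ⟨⟨by linarith, h4⟩, Or.inl h3⟩
  have hdisj : Disjoint (Set.Ioc (-z) (-ε)) (Set.Icc ε z) := by
    rw [Set.disjoint_left]
    intro t h3 h4
    linarith [h3.2, h4.1, hε.1]
  have hε' := hint ε hε.1
  rw [hset] at hε' ⊢
  rw [setIntegral_union hdisj measurableSet_Icc (hε'.mono_set Set.subset_union_left)
    (hε'.mono_set Set.subset_union_right), integral_Icc_eq_integral_Ioc,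
    ← intervalIntegral.integral_of_le (by linarith [hε.2]),
    ← intervalIntegral.integral_of_le hε.2.le, ← intervalIntegral.integral_comp_neg]
  have h0 : ∀ t ∈ Set.uIcc ε z, t ≠ 0 := by
    rw [Set.uIcc_of_le hε.2.le]
    exact fun t ht => (hε.1.trans_le ht.1).ne'
  have hi1 : IntervalIntegrable (fun t : ℝ => Real.exp t / t) volume ε z :=
    (continuousOn_exp_div.mono h0).intervalIntegrable
  have hi2 : IntervalIntegrable (fun t : ℝ => Real.exp (-t) / -t) volume ε z :=
    (continuousOn_exp_div.comp continuousOn_neg fun t ht =>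
      neg_ne_zero.2 (h0 t ht)).intervalIntegrable
  rw [← intervalIntegral.integral_add hi2 hi1]
  refine intervalIntegral.integral_congr fun t ht => ?_
  have ht := h0 t ht
  simp only [dslope_of_ne _ ht, slope_def_field, sub_zero, Real.sinh_zero]
  rw [Real.sinh_eq]
  field_simp
  ring

/-- The exponential integral is defined at all `z ≠ 0`. -/
theorem hasPVIntegral_expIntegralEi {z : ℝ} (hz : z ≠ 0) :
    HasPVIntegral (fun t : ℝ => Real.exp t / t) (Set.Iic z) 0 (expIntegralEi z) := by
  suffices h : ∃ L, HasPVIntegral (fun t : ℝ => Real.exp t / t) (Set.Iic z) 0 L by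
    obtain ⟨L, hL⟩ := h
    rwa [expIntegralEi, hL.2.limUnder_eq]
  have hneg : ∀ y : ℝ, y < 0 →
      HasPVIntegral (fun t : ℝ => Real.exp t / t) (Set.Iic y) 0
        (∫ t in Set.Iic y, Real.exp t / t) := by
    intro y hy
    have hd : Disjoint (Set.Iic y) (Metric.ball 0 (-y)) := by
      rw [Set.disjoint_left]
      intro t ht h
      rw [Metric.mem_ball, Real.dist_eq, sub_zero, abs_lt] at h
      linarith [Set.mem_Iic.1 ht, h.1]
    have hi := integrableOn_exp_div_diff_ball y (neg_pos.2 hy)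
    rw [hd.sdiff_eq_left] at hi
    exact HasPVIntegral.of_integrableOn hi (neg_pos.2 hy) hd
  rcases hz.lt_or_gt with h | h
  · exact ⟨_, hneg z h⟩
  · obtain ⟨L, hL⟩ := hasPVIntegral_exp_div_Ioc h
    have := (hneg (-z) (by linarith)).union hL measurableSet_Ioc
      (Set.Iic_disjoint_Ioc le_rfl)
    rw [Set.Iic_union_Ioc_eq_Iic (by linarith)] at this
    exact ⟨_, this⟩

theorem expIntegralEi_eq_add_integral {a z : ℝ} (ha : 0 < a) (hz : a ≤ z) :
    expIntegralEi z = expIntegralEi a + ∫ t in a..z, Real.exp t / t := by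
  have hi : IntegrableOn (fun t : ℝ => Real.exp t / t) (Set.Ioc a z) := by
    refine (continuousOn_exp_div.mono fun t ht => ?_).integrableOn_Icc.mono_set
      Set.Ioc_subset_Icc_self
    exact (ha.trans_le ht.1).ne'
  have hd : Disjoint (Set.Ioc a z) (Metric.ball 0 a) := by
    rw [Set.disjoint_left]
    intro t ht h
    rw [Metric.mem_ball, Real.dist_eq, sub_zero, abs_lt] at h
    linarith [ht.1, h.2]
  have h := (hasPVIntegral_expIntegralEi ha.ne').union (HasPVIntegral.of_integrableOn hi ha hd)
    measurableSet_Ioc (Set.Iic_disjoint_Ioc le_rfl)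
  rw [Set.Iic_union_Ioc_eq_Iic hz] at h
  rw [intervalIntegral.integral_of_le hz]
  exact tendsto_nhds_unique (hasPVIntegral_expIntegralEi (ha.trans_le hz).ne').2 h.2

/-! ### The asymptotic expansion of the exponential integral -/

theorem hasDerivAt_exp_mul_inv_pow (m : ℕ) {t : ℝ} (ht : t ≠ 0) :
    HasDerivAt (fun t : ℝ => Real.exp t * t⁻¹ ^ (m + 1))
      (Real.exp t * t⁻¹ ^ (m + 1) - (m + 1) * (Real.exp t * t⁻¹ ^ (m + 2))) t := by
  refine ((Real.hasDerivAt_exp t).mul ((hasDerivAt_inv ht).pow (m + 1))).congr_deriv ?_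
  simp only [Pi.pow_apply, Nat.add_sub_cancel, ← inv_pow]
  push_cast
  ring

/-- `e^t ∑_{k < N} k! / t^(k+1)`, the asymptotic expansion of `Ei t`. -/
noncomputable def eiPartialSum (N : ℕ) (t : ℝ) : ℝ :=
  ∑ k ∈ Finset.range N, k ! * (Real.exp t * t⁻¹ ^ (k + 1))

/-- The sum telescopes: differentiating it is the integration by parts behind the expansion. -/
theorem hasDerivAt_eiPartialSum (N : ℕ) {t : ℝ} (ht : t ≠ 0) :
    HasDerivAt (eiPartialSum N)
      (Real.exp t / t - N ! * (Real.exp t * t⁻¹ ^ (N + 1))) t := by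
  induction N with
  | zero =>
    refine (hasDerivAt_const t (0 : ℝ)).congr_deriv ?_
    simp [div_eq_mul_inv]
  | succ N ih =>
    have h : eiPartialSum (N + 1) =
        fun t => eiPartialSum N t + N ! * (Real.exp t * t⁻¹ ^ (N + 1)) := by
      ext t
      exact Finset.sum_range_succ _ _
    rw [h]
    refine (ih.add ((hasDerivAt_exp_mul_inv_pow N ht).const_mul _)).congr_deriv ?_
    rw [Nat.factorial_succ]
    push_cast
    ring

theorem expIntegralEi_sub_eiPartialSum_isBigO_atTop (N : ℕ) :
    (fun z => expIntegralEi z - eiPartialSum N z) =O[atTop]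
      fun z => Real.exp z * z⁻¹ ^ (N + 1) := by
  -- The difference has derivative `N! e^t / t^(N+1)`, which is integrated from `a` to `z`.
  set a : ℝ := 2 * (N + 1) with ha
  have ha0 : 0 < a := by positivity
  have hQ : ∀ z, a ≤ z → |expIntegralEi z - eiPartialSum N z| ≤
      |expIntegralEi a - eiPartialSum N a| + 2 * N ! * (Real.exp z * z⁻¹ ^ (N + 1)) := by
    intro z hz
    have hsub : Set.uIcc a z ⊆ ({0}ᶜ : Set ℝ) := by
      rw [Set.uIcc_of_le hz]
      exact fun t ht => (ha0.trans_le ht.1).ne'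
    have hi : ∀ m : ℕ, IntervalIntegrable (fun t : ℝ => Real.exp t * t⁻¹ ^ m) volume a z :=
      fun m => ((continuousOn_exp_mul_inv_pow m).mono hsub).intervalIntegrable
    have hi' : IntervalIntegrable (fun t : ℝ => Real.exp t / t) volume a z :=
      (continuousOn_exp_div.mono hsub).intervalIntegrable
    have h1 := intervalIntegral.integral_eq_sub_of_hasDerivAt
      (fun t ht => hasDerivAt_eiPartialSum N (hsub ht)) (hi'.sub ((hi (N + 1)).const_mul _))
    have h2 := intervalIntegral.integral_eq_sub_of_hasDerivAt
      (fun t ht => hasDerivAt_exp_mul_inv_pow N (hsub ht))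
      ((hi (N + 1)).sub ((hi (N + 2)).const_mul _))
    rw [intervalIntegral.integral_sub hi' ((hi (N + 1)).const_mul _),
      intervalIntegral.integral_const_mul] at h1
    have h3 : 0 ≤ ∫ t in a..z, Real.exp t * t⁻¹ ^ (N + 1) :=
      intervalIntegral.integral_nonneg hz fun t ht => by
        have := ha0.trans_le ht.1
        positivity
    -- For `t ≥ 2 (N + 1)` the derivative of `e^t / t^(N+1)` is at least half the function.
    have h4 : ∫ t in a..z, Real.exp t * t⁻¹ ^ (N + 1) ≤
        2 * ∫ t in a..z, (Real.exp t * t⁻¹ ^ (N + 1) -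
          (N + 1) * (Real.exp t * t⁻¹ ^ (N + 2))) := by
      rw [← intervalIntegral.integral_const_mul]
      refine intervalIntegral.integral_mono_on hz (hi _)
        (((hi (N + 1)).sub ((hi (N + 2)).const_mul _)).const_mul _) fun t ht => ?_
      have ht0 := ha0.trans_le ht.1
      have h5 : (N + 1) * t⁻¹ ≤ 1 / 2 := by
        rw [← div_eq_mul_inv, div_le_iff₀ ht0]
        linarith [ht.1]
      have h6 : 0 ≤ Real.exp t * t⁻¹ ^ (N + 1) := by positivity
      have h7 := mul_le_mul_of_nonneg_left h5 h6
      rw [pow_succ _ (N + 1)]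
      nlinarith [h7]
    rw [h2] at h4
    have h5 : 0 ≤ Real.exp a * a⁻¹ ^ (N + 1) := by positivity
    have h6 : (0 : ℝ) ≤ N ! := by positivity
    have h7 : N ! * ∫ t in a..z, Real.exp t * t⁻¹ ^ (N + 1) ≤
        N ! * (2 * (Real.exp z * z⁻¹ ^ (N + 1))) :=
      mul_le_mul_of_nonneg_left (by linarith) h6
    have h8 := mul_nonneg h6 h3
    rw [expIntegralEi_eq_add_integral ha0 hz]
    have h9 : expIntegralEi a + (∫ t in a..z, Real.exp t / t) - eiPartialSum N z =
        (expIntegralEi a - eiPartialSum N a) +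
          N ! * ∫ t in a..z, Real.exp t * t⁻¹ ^ (N + 1) := by linarith
    rw [h9]
    refine (abs_add_le _ _).trans ?_
    rw [abs_of_nonneg h8]
    linarith
  have hconst : (fun _ : ℝ => |expIntegralEi a - eiPartialSum N a|) =O[atTop]
      fun z => Real.exp z * z⁻¹ ^ (N + 1) := by
    refine (Asymptotics.isLittleO_const_left.2 (Or.inr ?_)).isBigO
    refine tendsto_norm_atTop_atTop.comp ((Real.tendsto_exp_div_pow_atTop (N + 1)).congr ?_)
    intro z
    rw [inv_pow, div_eq_mul_inv]
  refine Asymptotics.IsBigO.trans (Asymptotics.IsBigO.of_bound 1 ?_)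
    (hconst.add ((Asymptotics.isBigO_refl (fun z => Real.exp z * z⁻¹ ^ (N + 1))
      atTop).const_mul_left (2 * N !)))
  filter_upwards [eventually_ge_atTop a] with z hz
  rw [one_mul, Real.norm_eq_abs]
  exact (hQ z hz).trans (le_abs_self _)

theorem tendsto_eiPartialSum_atBot (N : ℕ) : Tendsto (eiPartialSum N) atBot (𝓝 0) := by
  have h : Tendsto (fun t => ∑ k ∈ Finset.range N, (k ! : ℝ) * (Real.exp t * t⁻¹ ^ (k + 1)))
      atBot (𝓝 (∑ k ∈ Finset.range N, (k ! : ℝ) * (0 * 0 ^ (k + 1)))) :=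
    tendsto_finsetSum _ fun k _ =>
      (Real.tendsto_exp_atBot.mul (tendsto_inv_atBot_zero.pow _)).const_mul _
  simp only [zero_mul, mul_zero, Finset.sum_const_zero] at h
  exact h

/-- Here the remainder is `N! ∫ e^t / t^(N+1) dt` over `(-∞, z]`. -/
theorem expIntegralEi_sub_eiPartialSum_isBigO_atBot (N : ℕ) :
    (fun z => expIntegralEi z - eiPartialSum N z) =O[atBot]
      fun z => Real.exp z * z⁻¹ ^ (N + 1) := by
  refine Asymptotics.IsBigO.of_bound (N ! : ℝ) ?_
  filter_upwards [eventually_lt_atBot 0] with z hz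
  have hne : ∀ t ∈ Set.Iic z, t ≠ 0 := fun t ht => (lt_of_le_of_lt ht hz).ne
  have hbound : ∀ m : ℕ, ∀ t ∈ Set.Iic z,
      ‖Real.exp t * t⁻¹ ^ m‖ ≤ Real.exp t * |z⁻¹| ^ m := by
    intro m t ht
    rw [norm_mul, norm_pow, Real.norm_eq_abs, Real.norm_eq_abs, Real.abs_exp, abs_inv, abs_inv,
      abs_of_neg hz, abs_of_neg (lt_of_le_of_lt ht hz)]
    have h1 : 0 < -z := by linarith
    have h2 : -z ≤ -t := neg_le_neg ht
    have h3 : 0 < -t := h1.trans_le h2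
    gcongr
  have hi : ∀ m : ℕ, IntegrableOn (fun t : ℝ => Real.exp t * t⁻¹ ^ m) (Set.Iic z) := by
    intro m
    refine Integrable.mono' ((integrableOn_exp_Iic z).mul_const (|z⁻¹| ^ m))
      (Real.measurable_exp.mul (measurable_inv.pow_const m)).aestronglyMeasurable ?_
    exact (ae_restrict_iff' measurableSet_Iic).2 (ae_of_all _ (hbound m))
  have hi' : IntegrableOn (fun t : ℝ => Real.exp t / t) (Set.Iic z) := by
    simpa [div_eq_mul_inv] using hi 1
  have h1 := integral_Iic_of_hasDerivAt_of_tendsto'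
    (fun t ht => hasDerivAt_eiPartialSum N (hne t ht)) (hi'.sub ((hi (N + 1)).const_mul _))
    (tendsto_eiPartialSum_atBot N)
  rw [integral_sub hi' ((hi (N + 1)).const_mul _), integral_const_mul, sub_zero] at h1
  have hd : Disjoint (Set.Iic z) (Metric.ball 0 (-z)) := by
    rw [Set.disjoint_left]
    intro t ht h
    rw [Metric.mem_ball, Real.dist_eq, sub_zero, abs_lt] at h
    linarith [Set.mem_Iic.1 ht, h.1]
  rw [← ((hasPVIntegral_expIntegralEi hz.ne).integrableOn_and_integral_eq (neg_pos.2 hz) hd).2,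
    ← h1, sub_sub_cancel, norm_mul, RCLike.norm_natCast]
  gcongr
  refine (norm_integral_le_of_norm_le ((integrableOn_exp_Iic z).mul_const (|z⁻¹| ^ (N + 1)))
    ((ae_restrict_iff' measurableSet_Iic).2 (ae_of_all _ (hbound _)))).trans ?_
  rw [integral_mul_const, integral_exp_Iic, norm_mul, norm_pow, Real.norm_eq_abs,
    Real.norm_eq_abs, Real.abs_exp]

/-! ### Asymptotic expansions -/

theorem hasAsymptoticExpansion_iff_trunc {f : ℝ → ℝ} {A : ℝ⟦X⟧} :
    HasAsymptoticExpansion f A ↔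
      ∀ N : ℕ, (fun x => f x - (PowerSeries.trunc N A).eval x) =O[𝓝[≠] 0] fun x : ℝ => x ^ N := by
  refine forall_congr' fun N => ?_
  have h : ∀ x : ℝ, (PowerSeries.trunc N A).eval x =
      ∑ n ∈ Finset.range N, PowerSeries.coeff n A * x ^ n := fun x =>
    PowerSeries.eval₂_trunc_eq_sum_range x (RingHom.id ℝ) N A
  simp only [h]

theorem polynomial_isBigO_one (p : Polynomial ℝ) :
    (fun x => p.eval x) =O[𝓝[≠] 0] fun _ : ℝ => (1 : ℝ) :=
  (p.continuous.tendsto 0).isBigO_one ℝ |>.mono nhdsWithin_le_nhds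

theorem polynomial_isBigO_pow {p : Polynomial ℝ} {N : ℕ} (h : ∀ n < N, p.coeff n = 0) :
    (fun x => p.eval x) =O[𝓝[≠] 0] fun x : ℝ => x ^ N := by
  obtain ⟨q, rfl⟩ := Polynomial.X_pow_dvd_iff.2 h
  simpa using (Asymptotics.isBigO_refl (fun x : ℝ => x ^ N) _).mul (polynomial_isBigO_one q)

namespace HasAsymptoticExpansion

theorem of_polynomial (p : Polynomial ℝ) : HasAsymptoticExpansion (fun x => p.eval x) p := by
  refine hasAsymptoticExpansion_iff_trunc.2 fun N => ?_
  simp only [← Polynomial.eval_sub]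
  refine polynomial_isBigO_pow fun n hn => ?_
  simp [PowerSeries.coeff_trunc, hn]

theorem add {f g : ℝ → ℝ} {A B : ℝ⟦X⟧} (hf : HasAsymptoticExpansion f A)
    (hg : HasAsymptoticExpansion g B) : HasAsymptoticExpansion (fun x => f x + g x) (A + B) := by
  refine hasAsymptoticExpansion_iff_trunc.2 fun N => ?_
  refine ((hasAsymptoticExpansion_iff_trunc.1 hf N).add
    (hasAsymptoticExpansion_iff_trunc.1 hg N)).congr_left fun x => ?_
  rw [map_add, Polynomial.eval_add]
  ring

theorem isBigO_one {f : ℝ → ℝ} {A : ℝ⟦X⟧} (hf : HasAsymptoticExpansion f A) :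
    f =O[𝓝[≠] 0] fun _ => (1 : ℝ) := by
  simpa using hf 0

theorem mul {f g : ℝ → ℝ} {A B : ℝ⟦X⟧} (hf : HasAsymptoticExpansion f A)
    (hg : HasAsymptoticExpansion g B) : HasAsymptoticExpansion (fun x => f x * g x) (A * B) := by
  refine hasAsymptoticExpansion_iff_trunc.2 fun N => ?_
  set a := PowerSeries.trunc N A
  set b := PowerSeries.trunc N B
  have h1 : (fun x => (f x - a.eval x) * g x) =O[𝓝[≠] 0] fun x : ℝ => x ^ N := by
    simpa using (hasAsymptoticExpansion_iff_trunc.1 hf N).mul hg.isBigO_one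
  have h2 : (fun x => a.eval x * (g x - b.eval x)) =O[𝓝[≠] 0] fun x : ℝ => x ^ N := by
    simpa using (polynomial_isBigO_one a).mul (hasAsymptoticExpansion_iff_trunc.1 hg N)
  have h3 : (fun x => (a * b - PowerSeries.trunc N (A * B)).eval x) =O[𝓝[≠] 0]
      fun x : ℝ => x ^ N := by
    refine polynomial_isBigO_pow fun n hn => ?_
    have h := congrArg (fun p : Polynomial ℝ => p.coeff n)
      (PowerSeries.trunc_trunc_mul_trunc (f := A) (g := B) (n := N))
    simp only [PowerSeries.coeff_trunc, hn, if_true] at h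
    rw [Polynomial.coeff_sub, PowerSeries.coeff_trunc, if_pos hn, ← h, ← Polynomial.coe_mul,
      Polynomial.coeff_coe, sub_self]
  refine ((h1.add h2).add h3).congr_left fun x => ?_
  rw [Polynomial.eval_sub, Polynomial.eval_mul]
  ring

theorem const (c : ℝ) : HasAsymptoticExpansion (fun _ => c) (PowerSeries.C c) := by
  simpa using of_polynomial (Polynomial.C c)

theorem id : HasAsymptoticExpansion (fun x => x) PowerSeries.X := by
  simpa using of_polynomial Polynomial.X

theorem pow {f : ℝ → ℝ} {A : ℝ⟦X⟧} (hf : HasAsymptoticExpansion f A) (k : ℕ) :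
    HasAsymptoticExpansion (fun x => f x ^ k) (A ^ k) := by
  induction k with
  | zero => simpa using const 1
  | succ k ih => simpa only [pow_succ] using ih.mul hf

theorem sum {ι : Type*} (s : Finset ι) {f : ι → ℝ → ℝ} {A : ι → ℝ⟦X⟧}
    (hf : ∀ i, HasAsymptoticExpansion (f i) (A i)) :
    HasAsymptoticExpansion (fun x => ∑ i ∈ s, f i x) (∑ i ∈ s, A i) := by
  classical
  induction s using Finset.induction_on with
  | empty => simpa using const 0
  | insert i s hi ih =>
    simp only [Finset.sum_insert hi]
    exact (hf i).add ih

theorem inv_one_add :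
    HasAsymptoticExpansion (fun x => (1 + x)⁻¹) (1 + PowerSeries.X)⁻¹ := by
  have hA : (1 + PowerSeries.X : ℝ⟦X⟧)⁻¹ = PowerSeries.mk fun n => (-1) ^ n := by
    rw [PowerSeries.inv_eq_iff_mul_eq_one (by simp), mul_add, mul_one]
    ext n
    rcases n with _ | n
    · simp
    · simp [PowerSeries.coeff_succ_mul_X, PowerSeries.coeff_one, pow_succ]
  intro N
  have hne : ∀ᶠ x : ℝ in 𝓝[≠] 0, 1 + x ≠ 0 := by
    have : Tendsto (fun x : ℝ => 1 + x) (𝓝 0) (𝓝 (1 + 0)) := tendsto_const_nhds.add tendsto_id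
    exact (this.mono_left nhdsWithin_le_nhds).eventually_ne (by norm_num)
  have h1 : (fun x : ℝ => (1 + x)⁻¹) =O[𝓝[≠] 0] fun _ => (1 : ℝ) := by
    have : Tendsto (fun x : ℝ => (1 + x)⁻¹) (𝓝 0) (𝓝 (1 + 0)⁻¹) :=
      (tendsto_const_nhds.add tendsto_id).inv₀ (by norm_num)
    exact (this.mono_left nhdsWithin_le_nhds).isBigO_one ℝ
  have h2 : (fun x : ℝ => (-1) ^ N * x ^ N * (1 + x)⁻¹) =O[𝓝[≠] 0] fun x : ℝ => x ^ N := by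
    simpa using ((Asymptotics.isBigO_refl (fun x : ℝ => x ^ N) _).const_mul_left
      ((-1) ^ N)).mul h1
  refine h2.congr' ?_ EventuallyEq.rfl
  filter_upwards [hne] with x hx
  have h3 := mul_neg_geom_sum (-x) N
  simp only [hA, PowerSeries.coeff_mk, ← mul_pow, neg_one_mul]
  rw [← mul_right_inj' hx, mul_sub, mul_inv_cancel₀ hx]
  rw [sub_neg_eq_add] at h3
  rw [h3]
  field_simp
  ring

end HasAsymptoticExpansion

/-! ### The closed form -/

/-- The remainder of the expansion of `Ei` at `z = (x + 1)² / x`: here `z⁻¹ = x / (1 + x)²`, and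
`z` tends to `+∞` as `x → 0+` and to `-∞` as `x → 0-`. -/
theorem eiTerm_sub_isBigO (N : ℕ) :
    (fun x : ℝ => eiTerm x - (1 - x) * (1 + x)⁻¹ *
      ∑ k ∈ Finset.range N, (k ! : ℝ) * (x * (1 + x)⁻¹ ^ 2) ^ k) =O[𝓝[≠] 0]
      fun x : ℝ => x ^ N := by
  have hbase : ∀ l : Filter ℝ,
      (fun z => expIntegralEi z - eiPartialSum N z) =O[l]
        (fun z => Real.exp z * z⁻¹ ^ (N + 1)) →
      (fun z => Real.exp (-z) * (expIntegralEi z - eiPartialSum N z)) =O[l]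
        (fun z => z⁻¹ ^ (N + 1)) := by
    intro l h
    refine ((Asymptotics.isBigO_refl (fun z => Real.exp (-z)) l).mul h).congr_right fun z => ?_
    rw [← mul_assoc, ← Real.exp_add, neg_add_cancel, Real.exp_zero, one_mul]
  have hz : ∀ l : Filter ℝ, l ≤ 𝓝 0 → Tendsto (fun x : ℝ => (x + 1) ^ 2) l (𝓝 1) := by
    intro l hl
    have : Tendsto (fun x : ℝ => (x + 1) ^ 2) (𝓝 0) (𝓝 ((0 + 1) ^ 2)) :=
      (tendsto_id.add tendsto_const_nhds).pow 2
    simpa using this.mono_left hl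
  have hpos : Tendsto (fun x : ℝ => (x + 1) ^ 2 / x) (𝓝[>] 0) atTop := by
    simpa only [div_eq_mul_inv] using
      (hz _ nhdsWithin_le_nhds).pos_mul_atTop one_pos tendsto_inv_nhdsGT_zero
  have hneg : Tendsto (fun x : ℝ => (x + 1) ^ 2 / x) (𝓝[<] 0) atBot := by
    simpa only [div_eq_mul_inv] using
      (hz _ nhdsWithin_le_nhds).pos_mul_atBot one_pos tendsto_inv_nhdsLT_zero
  have h1 : (fun x : ℝ => Real.exp (-((x + 1) ^ 2 / x)) * (expIntegralEi ((x + 1) ^ 2 / x) -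
      eiPartialSum N ((x + 1) ^ 2 / x))) =O[𝓝[≠] 0]
      fun x : ℝ => ((x + 1) ^ 2 / x)⁻¹ ^ (N + 1) := by
    rw [← nhdsLT_sup_nhdsGT]
    exact Asymptotics.IsBigO.sup
      ((hbase _ (expIntegralEi_sub_eiPartialSum_isBigO_atBot N)).comp_tendsto hneg)
      ((hbase _ (expIntegralEi_sub_eiPartialSum_isBigO_atTop N)).comp_tendsto hpos)
  have hne : ∀ᶠ x : ℝ in 𝓝[≠] 0, x ≠ 0 ∧ 1 + x ≠ 0 := by
    have : Tendsto (fun x : ℝ => 1 + x) (𝓝 0) (𝓝 (1 + 0)) := tendsto_const_nhds.add tendsto_id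
    exact (eventually_mem_nhdsWithin).and
      ((this.mono_left nhdsWithin_le_nhds).eventually_ne (by norm_num))
  have h2 : (fun x : ℝ => (1 - x ^ 2) * ((x + 1) ^ 2)⁻¹ ^ (N + 1)) =O[𝓝[≠] 0]
      fun _ => (1 : ℝ) := by
    have : Tendsto (fun x : ℝ => (1 - x ^ 2) * ((x + 1) ^ 2)⁻¹ ^ (N + 1)) (𝓝[≠] 0)
        (𝓝 ((1 - 0 ^ 2) * 1⁻¹ ^ (N + 1))) := by
      refine Tendsto.mul ?_ (((hz _ nhdsWithin_le_nhds).inv₀ one_ne_zero).pow _)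
      exact (tendsto_const_nhds.sub (tendsto_id.pow 2)).mono_left nhdsWithin_le_nhds
    exact this.isBigO_one ℝ
  have h3 : (fun x : ℝ => (1 - x ^ 2) / x * ((x + 1) ^ 2 / x)⁻¹ ^ (N + 1)) =O[𝓝[≠] 0]
      fun x : ℝ => x ^ N := by
    have h4 : (fun x : ℝ => (1 - x ^ 2) * ((x + 1) ^ 2)⁻¹ ^ (N + 1) * x ^ N) =O[𝓝[≠] 0]
        fun x : ℝ => x ^ N := by
      simpa only [one_mul] using h2.mul (Asymptotics.isBigO_refl (fun x : ℝ => x ^ N) _)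
    refine h4.congr' ?_ EventuallyEq.rfl
    filter_upwards [hne] with x hx
    have := hx.1
    rw [inv_div, div_pow, inv_pow, pow_succ x N]
    field_simp
  refine (((Asymptotics.isBigO_refl (fun x : ℝ => (1 - x ^ 2) / x) _).mul h1).trans h3).congr'
    ?_ EventuallyEq.rfl
  filter_upwards [hne] with x hx
  have hx0 := hx.1
  have hx1 := hx.2
  have hsum : Real.exp (-((x + 1) ^ 2 / x)) * eiPartialSum N ((x + 1) ^ 2 / x) =
      x * (1 + x)⁻¹ ^ 2 * ∑ k ∈ Finset.range N, (k ! : ℝ) * (x * (1 + x)⁻¹ ^ 2) ^ k := by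
    have hw : ((x + 1) ^ 2 / x)⁻¹ = x * (1 + x)⁻¹ ^ 2 := by
      rw [inv_div, add_comm, inv_pow, div_eq_mul_inv]
    rw [eiPartialSum, Finset.mul_sum, Finset.mul_sum, hw]
    refine Finset.sum_congr rfl fun k _ => ?_
    have he : Real.exp (-((x + 1) ^ 2 / x)) * Real.exp ((x + 1) ^ 2 / x) = 1 := by
      rw [← Real.exp_add, neg_add_cancel, Real.exp_zero]
    rw [pow_succ _ k]
    generalize Real.exp (-((x + 1) ^ 2 / x)) = p at he ⊢
    generalize Real.exp ((x + 1) ^ 2 / x) = q at he ⊢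
    linear_combination ((k ! : ℝ) * (x * (1 + x)⁻¹ ^ 2) ^ k * (x * (1 + x)⁻¹ ^ 2)) * he
  rw [mul_sub, mul_sub, hsum, eiTerm, ← mul_assoc, ← mul_assoc]
  congr 2
  field_simp
  ring

theorem hasAsymptoticExpansion_menageEGF :
    HasAsymptoticExpansion (fun x : ℝ => -1 + 2 * x + 2 * eiTerm x) menageEGF := by
  intro N
  -- Both sides are compared with the first `N` terms of the factorial series.
  have hS := ((HasAsymptoticExpansion.const (-1)).add
    ((HasAsymptoticExpansion.const 2).mul HasAsymptoticExpansion.id)).add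
    ((HasAsymptoticExpansion.const 2).mul
      ((((HasAsymptoticExpansion.const 1).add
        ((HasAsymptoticExpansion.const (-1)).mul HasAsymptoticExpansion.id)).mul
          HasAsymptoticExpansion.inv_one_add).mul
        (HasAsymptoticExpansion.sum (Finset.range N) fun k =>
          (HasAsymptoticExpansion.const (k ! : ℝ)).mul
            ((HasAsymptoticExpansion.id.mul (HasAsymptoticExpansion.inv_one_add.pow 2)).pow k))))
  have h := (hS N).add ((eiTerm_sub_isBigO N).const_mul_left 2)
  refine h.congr_left fun x => ?_
  have hcoeff : ∀ n ∈ Finset.range N, PowerSeries.coeff n menageEGF =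
      PowerSeries.coeff n (PowerSeries.C (-1) + PowerSeries.C 2 * PowerSeries.X +
        PowerSeries.C 2 * ((PowerSeries.C 1 + PowerSeries.C (-1) * PowerSeries.X) *
          (1 + PowerSeries.X)⁻¹ * ∑ k ∈ Finset.range N, PowerSeries.C (k ! : ℝ) *
            (PowerSeries.X * (1 + PowerSeries.X)⁻¹ ^ 2) ^ k) : ℝ⟦X⟧) := by
    intro n hn
    have h2 : (2 : ℝ⟦X⟧) = PowerSeries.C 2 := (map_ofNat _ 2).symm
    have hD : (PowerSeries.C 1 + PowerSeries.C (-1) * PowerSeries.X : ℝ⟦X⟧) =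
        1 - PowerSeries.X := by
      rw [map_neg, map_one]
      ring
    rw [menageEGF_eq_formalLaplace, h2, map_add, PowerSeries.coeff_C_mul,
      coeff_formalLaplace_formalKernel (Finset.mem_range.1 hn), ← map_sum, ← Finset.mul_sum, hD,
      ← PowerSeries.coeff_C_mul, ← map_add, map_neg, map_one]
    rfl
  have hsum : ∑ n ∈ Finset.range N, PowerSeries.coeff n menageEGF * x ^ n = _ :=
    Finset.sum_congr rfl fun n hn => congrArg (· * x ^ n) (hcoeff n hn)
  rw [hsum]
  ring

theorem hasPVIntegral_menageKernel {x : ℝ} (hx0 : x ≠ 0) (hx1 : x ≠ -1) :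
    HasPVIntegral (fun t : ℝ => (x ^ 2 - 1) / (x * t - (x + 1) ^ 2) * Real.exp (-t))
      (Set.Ioi 0) ((x + 1) ^ 2 / x) (eiTerm x) := by
  have hx2 : x + 1 ≠ 0 := fun h => hx1 (by linarith)
  have h := ((hasPVIntegral_expIntegralEi (z := (x + 1) ^ 2 / x)
    (div_ne_zero (pow_ne_zero 2 hx2) hx0)).comp_sub_left).const_mul
      ((1 - x ^ 2) / x * Real.exp (-((x + 1) ^ 2 / x)))
  refine (congrArg (fun f => HasPVIntegral f (Set.Ioi 0) ((x + 1) ^ 2 / x) (eiTerm x))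
    (funext fun t => ?_)).mp h
  have he : Real.exp ((x + 1) ^ 2 / x - t) =
      Real.exp ((x + 1) ^ 2 / x) * Real.exp (-t) := by
    rw [← Real.exp_add, sub_eq_add_neg]
  have he' : Real.exp (-((x + 1) ^ 2 / x)) * Real.exp ((x + 1) ^ 2 / x) = 1 := by
    rw [← Real.exp_add, neg_add_cancel, Real.exp_zero]
  have hd : x * t - (x + 1) ^ 2 = -x * ((x + 1) ^ 2 / x - t) := by
    field_simp
    ring
  rw [hd, he]
  calc _ = (1 - x ^ 2) / x * (Real.exp (-((x + 1) ^ 2 / x)) * Real.exp ((x + 1) ^ 2 / x)) *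
        (Real.exp (-t) / ((x + 1) ^ 2 / x - t)) := by ring
    _ = _ := by
      rw [he', mul_one, neg_mul, div_neg, ← neg_div, neg_sub, ← div_div]
      ring

theorem mainTheorem1 :
    -- the integral formula for the menage numbers
    (∀ n : ℕ, 1 < n →
      IntegrableOn
        (fun t : ℝ => (lambdaPlus t ^ n + lambdaMinus t ^ n) * (Real.exp (-t) : ℂ))
        (Set.Ioi 0) ∧
      (menageNumber n : ℂ) =
        2 * (n ! : ℂ) *
          ∫ t in Set.Ioi (0 : ℝ),
            (lambdaPlus t ^ n + lambdaMinus t ^ n) * (Real.exp (-t) : ℂ)) ∧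
    -- the integral form of the generating function, as a formal power series
    ((∀ n : ℕ, IntegrableOn
        (fun t : ℝ => PowerSeries.coeff n (formalKernel t) * Real.exp (-t)) (Set.Ioi 0)) ∧
      menageEGF = -1 + 2 * PowerSeries.X + 2 * formalLaplace formalKernel) ∧
    -- the series form of the generating function
    (Summable (fun k : ℕ =>
        PowerSeries.C (k ! : ℝ) * PowerSeries.X ^ k * ((1 + PowerSeries.X) ^ (2 * k))⁻¹) ∧
      menageEGF = -1 + 2 * PowerSeries.X +
        2 * ((1 - PowerSeries.X) * (1 + PowerSeries.X)⁻¹) *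
          ∑' k : ℕ,
            PowerSeries.C (k ! : ℝ) * PowerSeries.X ^ k *
              ((1 + PowerSeries.X) ^ (2 * k))⁻¹) ∧
    -- the closed form through the exponential integral: `Ei` is well defined at all arguments
    -- that occur, and the generating function is the asymptotic expansion of the closed form
    (∀ x : ℝ, x ≠ 0 → x ≠ -1 →
      HasPVIntegral (fun t : ℝ => Real.exp t / t) (Set.Iic ((x + 1) ^ 2 / x)) 0
        (expIntegralEi ((x + 1) ^ 2 / x))) ∧
    HasAsymptoticExpansion (fun x : ℝ => -1 + 2 * x + 2 * eiTerm x) menageEGF ∧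
    -- the integral form and the closed form are equal as functions of a real variable
    (∀ x : ℝ, x < 0 → x ≠ -1 →
      IntegrableOn
        (fun t : ℝ => (x ^ 2 - 1) / (x * t - (x + 1) ^ 2) * Real.exp (-t)) (Set.Ioi 0) ∧
      -1 + 2 * x + 2 * (∫ t in Set.Ioi (0 : ℝ),
          (x ^ 2 - 1) / (x * t - (x + 1) ^ 2) * Real.exp (-t)) =
        -1 + 2 * x + 2 * eiTerm x) ∧
    (∀ x : ℝ, 0 < x →
      HasPVIntegral
        (fun t : ℝ => (x ^ 2 - 1) / (x * t - (x + 1) ^ 2) * Real.exp (-t))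
        (Set.Ioi 0) ((x + 1) ^ 2 / x) (eiTerm x)) := by
  refine ⟨fun n hn => ?_, ⟨integrableOn_coeff_formalKernel, menageEGF_eq_formalLaplace⟩, ?_,
    fun x hx0 hx1 => ?_, hasAsymptoticExpansion_menageEGF, fun x hx hx1 => ?_, fun x hx => ?_⟩
  · have h : ∀ t : ℝ, (lambdaPlus t ^ n + lambdaMinus t ^ n) * (Real.exp (-t) : ℂ) =
        (((menagePoly n).eval t * Real.exp (-t) : ℝ) : ℂ) := fun t => by
      rw [lambdaPlus_pow_add_lambdaMinus_pow, Complex.ofReal_mul]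
    simp only [h]
    refine ⟨(integrableOn_eval_mul_exp_neg _).ofReal, ?_⟩
    rw [integral_complex_ofReal, ← Complex.ofReal_natCast, menageNumber_eq_integral hn]
    push_cast
    ring
  · simp only [mul_assoc (PowerSeries.C _), X_pow_mul_inv_one_add_X_pow]
    refine ⟨summable_factorial_mul_koebeSeries_pow, ?_⟩
    rw [menageEGF_eq_formalLaplace, formalLaplace_formalKernel_eq_tsum]
    ring
  · have hx2 : x + 1 ≠ 0 := fun h => hx1 (by linarith)
    exact hasPVIntegral_expIntegralEi (div_ne_zero (pow_ne_zero 2 hx2) hx0)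
  · have hx2 : x + 1 ≠ 0 := fun h => hx1 (by linarith)
    have hc : (x + 1) ^ 2 / x < 0 := div_neg_of_pos_of_neg (by positivity) hx
    have hd : Disjoint (Set.Ioi (0 : ℝ)) (Metric.ball ((x + 1) ^ 2 / x)
        (-((x + 1) ^ 2 / x))) := by
      rw [Set.disjoint_left]
      intro t ht h
      rw [Metric.mem_ball, Real.dist_eq, abs_lt] at h
      linarith [Set.mem_Ioi.1 ht, h.2]
    obtain ⟨h1, h2⟩ :=
      (hasPVIntegral_menageKernel hx.ne hx1).integrableOn_and_integral_eq (neg_pos.2 hc) hd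
    exact ⟨h1, by rw [h2]⟩
  · exact hasPVIntegral_menageKernel hx.ne' (by linarith)
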